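/- \textbf{Notation.} Let $I=[0,1]$. For a space $X$ write $F\subset_{cl}X$ if $F$ is a closed (possibly empty) subset of $X$. $\mathbf{Comp}$ is the category of compact Hausdorff spaces and $\mathbf{Tych}$ the category of Tychonoff ($T_0$ completely regular) spaces, with continuous maps as morphisms; $U:\mathbf{Comp}\to\mathbf{Tych}$ is the inclusion functor. $\beta X$ is the Stone--Čech compactification of $X$. A \emph{capacity} on a compact Hausdorff space $X$ is a function $c$ from the closed subsets of $X$ to $I$ such that $c(\emptyset)=0$, $c(X)=1$, $c(F)\le c(G)$ whenever $F\subset G$, and, whenever $c(F)<a$, there is an open $U\supset F$ with $c(G)<a$ for all closed $G\subset U$. The set $MX$ of all capacities carries the topology with the subbase of all sets $\{c: c(F)<a\}$ and $\{c:\ c(F)>a\text{ for some compact }F\subset U\}$, where $F\subset X$ is closed, $U\subset X$ is open and $a\in\mathbb R$; with $Mf(c)(F)=c(f^{-1}(F))$ this gives a functor $M:\mathbf{Comp}\to\mathbf{Comp}$. A \emph{$\tau$-smooth capacity} on a Tychonoff space $X$ is a function $c$ from the closed subsets of $X$ to $I$ such that $c(\emptyset)=0$, $c(X)=1$, $c$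 is monotone, and $\inf_i c(F_i)\le c(G)$ for each monotonically decreasing net $(F_i)$ of closed sets and each closed $G$ with $\bigcap_i F_i\subset G$. Let $\check MX$ be the set of all of them and let $e_X:\check MX\to M\beta X$, $e_X(c)(F)=c(F\cap X)$ for $F\subset_{cl}\beta X$. Give $\check MX$ the topology induced by $e_X$. With $\check Mf(c)(F)=c(f^{-1}(F))$ this gives a functor $\check M:\mathbf{Tych}\to\mathbf{Tych}$. \textbf{Theorem.} (1) For each Tychonoff space $X$ the map $e_X$ is a topological embedding whose image consists of exactly those capacities $c$ on $\beta X$ that satisfy $c(F)\le c(G)$ for all $F,G\subset_{cl}\beta X$ with $F\cap X\subset G$. (2) The formulae $$\check\eta_X(x)(F)=\begin{cases}1,&x\in F,\\0,&x\notin F,\end{cases}\qquad \check\mu_X(C)(F)=\sup_{\alpha\in I}\bigl(\alpha\wedge C(\{c\in\check MX: c(F)\ge\alpha\})\bigr),$$ for $x\in X$, $C\in\check M\check MX$, $F\subset_{cl}X$, define natural transformations $\check\eta:\mathbf 1_{\mathbf{Tych}}\to\check M$ and $\check\mu:\check M^2\to\check M$, and $(\check M,\check\eta,\check\mu)$ is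 a monad in $\mathbf{Tych}$. (3) This monad extends the capacity monad on compacta: the formulae $\eta_X(x)(F)=1$ if $x\in F$ and $0$ otherwise, and $\mu_X(C)(F)=\sup\{\alpha\in I: C(\{c\in MX: c(F)\ge\alpha\})\ge\alpha\}$, define a monad $(M,\eta,\mu)$ in $\mathbf{Comp}$, and for each compact Hausdorff space $X$ the map which is the identity on set functions is a homeomorphism $\check MX\to MX$, natural in $X$, that carries $\check\eta_X$ to $\eta_X$ and $\check\mu_X$ to $\mu_X$. -/

import Mathlib

open CategoryTheory TopologicalSpace Topology unitInterval

universe u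

namespace CapacityMonad

/-! ### Capacities on compacta -/

/-- A capacity on a compactum `X`: a normalized monotone upper semicontinuous function
on the closed subsets of `X` (the empty one included) with values in the unit segment. -/
structure Capacity (X : Type u) [TopologicalSpace X] where
  toFun : Closeds X → I
  map_bot' : toFun ⊥ = 0
  map_top' : toFun ⊤ = 1
  mono' : Monotone toFun
  usc' : ∀ (F : Closeds X) (a : ℝ), (toFun F : ℝ) < a →
    ∃ U : Opens X, (F : Set X) ⊆ U ∧ ∀ G : Closeds X, (G : Set X) ⊆ U → (toFun G : ℝ) < a

namespace Capacity

variable {X Y Z : Type u} [TopologicalSpace X] [TopologicalSpace Y] [TopologicalSpace Z]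

instance : FunLike (Capacity X) (Closeds X) I where
  coe := toFun
  coe_injective c c' h := by cases c; cases c'; congr

@[ext] theorem ext {c c' : Capacity X} (h : ∀ F, c F = c' F) : c = c' := DFunLike.ext _ _ h

theorem mono (c : Capacity X) {F G : Closeds X} (h : F ≤ G) : c F ≤ c G := c.mono' h

theorem map_bot (c : Capacity X) : c ⊥ = 0 := c.map_bot'

theorem map_top (c : Capacity X) : c ⊤ = 1 := c.map_top'

theorem usc (c : Capacity X) (F : Closeds X) (a : ℝ) (h : (c F : ℝ) < a) :
    ∃ U : Opens X, (F : Set X) ⊆ U ∧ ∀ G : Closeds X, (G : Set X) ⊆ U → (c G : ℝ) < a :=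
  c.usc' F a h

/-- The topology on the set of capacities: the subbase consists of the sets
`O₋(F, a) = {c | c(F) < a}`, `F` closed, and
`O₊(U, a) = {c | c(F) > a for some compact (= closed) F ⊆ U}`, `U` open, with `a` real. -/
instance : TopologicalSpace (Capacity X) :=
  generateFrom
    ({s | ∃ (F : Closeds X) (a : ℝ), s = {c : Capacity X | (c F : ℝ) < a}} ∪
     {s | ∃ (U : Opens X) (a : ℝ),
        s = {c : Capacity X | ∃ F : Closeds X, (F : Set X) ⊆ U ∧ a < (c F : ℝ)}})

theorem isOpen_lt (F : Closeds X) (a : ℝ) : IsOpen {c : Capacity X | (c F : ℝ) < a} :=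
  isOpen_generateFrom_of_mem (Or.inl ⟨F, a, rfl⟩)

theorem isOpen_gt (U : Opens X) (a : ℝ) :
    IsOpen {c : Capacity X | ∃ F : Closeds X, (F : Set X) ⊆ U ∧ a < (c F : ℝ)} :=
  isOpen_generateFrom_of_mem (Or.inr ⟨U, a, rfl⟩)

/-- The set of all capacities `c` with `c(F) ≥ α`. It is closed. -/
def superlevel (F : Closeds X) (α : I) : Closeds (Capacity X) where
  carrier := {c | α ≤ c F}
  isClosed' := by
    have h := (isOpen_lt F (α : ℝ)).isClosed_compl
    convert h using 1
    ext c
    simp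

theorem exists_between [CompactSpace X] [T2Space X] {F : Closeds X} {U : Opens X}
    (h : (F : Set X) ⊆ U) :
    ∃ (V : Opens X) (G : Closeds X), (F : Set X) ⊆ V ∧ (V : Set X) ⊆ G ∧ (G : Set X) ⊆ U := by
  obtain ⟨V, hV, hFV, hVU⟩ := normal_exists_closure_subset F.isClosed U.isOpen h
  exact ⟨⟨V, hV⟩, ⟨closure V, isClosed_closure⟩, hFV, subset_closure, hVU⟩

instance [CompactSpace X] [T2Space X] : T2Space (Capacity X) := by
  have key : ∀ (c c' : Capacity X) (F : Closeds X), c F < c' F →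
      ∃ u v : Set (Capacity X), IsOpen u ∧ IsOpen v ∧ c ∈ u ∧ c' ∈ v ∧ Disjoint u v := by
    intro c c' F h
    obtain ⟨b, hb, hb'⟩ := _root_.exists_between (show (c F : ℝ) < c' F from h)
    obtain ⟨U, hFU, hU⟩ := c.usc F b hb
    obtain ⟨V, G, hFV, hVG, hGU⟩ := Capacity.exists_between hFU
    refine ⟨_, _, isOpen_lt G b, isOpen_gt V b, hU G hGU, ⟨F, hFV, hb'⟩, ?_⟩
    rw [Set.disjoint_left]
    rintro d (hd : (d G : ℝ) < b) ⟨H, hH, hd'⟩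
    have : (d H : ℝ) ≤ d G := d.mono (hH.trans hVG)
    linarith
  refine ⟨fun c c' hne => ?_⟩
  obtain ⟨F, hF⟩ := DFunLike.ne_iff.mp hne
  rcases lt_or_gt_of_ne hF with h | h
  · exact key c c' F h
  · obtain ⟨u, v, hu, hv, h1, h2, h3⟩ := key c' c F h
    exact ⟨v, u, hv, hu, h2, h1, h3.symm⟩

instance [CompactSpace X] [T2Space X] : CompactSpace (Capacity X) := by
  refine ⟨isCompact_iff_ultrafilter_le_nhds.mpr fun 𝒰 _ => ?_⟩
  have hlim : ∀ F : Closeds X, ∃ x : I, Filter.Tendsto (fun c : Capacity X => c F) 𝒰 (𝓝 x) := by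
    intro F
    obtain ⟨x, -, hx⟩ := isCompact_iff_ultrafilter_le_nhds.mp (isCompact_univ (X := I))
      (𝒰.map fun c => c F) (by simp)
    exact ⟨x, hx⟩
  choose g hg using hlim
  have gmono : Monotone g := fun F G h =>
    le_of_tendsto_of_tendsto' (hg F) (hg G) fun c => c.mono h
  have gbot : g ⊥ = 0 := tendsto_nhds_unique (hg ⊥) (by simp [map_bot])
  have gtop : g ⊤ = 1 := tendsto_nhds_unique (hg ⊤) (by simp [map_top])
  -- closed neighbourhoods
  let N : Closeds X → Set (Closeds X) := fun F =>
    {G | ∃ V : Opens X, (F : Set X) ⊆ V ∧ (V : Set X) ⊆ G}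
  let k : Closeds X → I := fun F => sInf (g '' N F)
  have kle : ∀ F G, G ∈ N F → k F ≤ g G := fun F G h => sInf_le ⟨G, h, rfl⟩
  have gk : ∀ F, g F ≤ k F := by
    intro F
    refine le_sInf ?_
    rintro _ ⟨G, ⟨V, h1, h2⟩, rfl⟩
    exact gmono (h1.trans h2)
  have klt : ∀ F (a : ℝ), (k F : ℝ) < a → ∃ G ∈ N F, (g G : ℝ) < a := by
    intro F a h
    by_contra! hcon
    by_cases ha : a ≤ 1
    · have ha0 : 0 ≤ a := (k F).2.1.trans h.le
      have : (⟨a, ha0, ha⟩ : I) ≤ k F := by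
        refine le_sInf ?_
        rintro _ ⟨G, hG, rfl⟩
        exact hcon G hG
      exact absurd (show a ≤ (k F : ℝ) from this) (not_le.mpr h)
    · have := hcon ⊤ ⟨⊤, by simp, by simp⟩
      exact ha (this.trans (g ⊤).2.2)
  let c : Capacity X :=
    { toFun := k
      map_bot' := le_antisymm
        ((kle ⊥ ⊥ ⟨⊥, by simp, by simp⟩).trans gbot.le) (k ⊥).2.1
      map_top' := le_antisymm (k ⊤).2.2 (gtop.ge.trans (gk ⊤))
      mono' := by
        intro F G h
        refine sInf_le_sInf (Set.image_mono ?_)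
        rintro H ⟨V, h1, h2⟩
        exact ⟨V, Set.Subset.trans h h1, h2⟩
      usc' := by
        intro F a h
        obtain ⟨G, ⟨V, h1, h2⟩, h3⟩ := klt F a h
        exact ⟨V, h1, fun H hH => lt_of_le_of_lt (kle H G ⟨V, hH, h2⟩) h3⟩ }
  have ev_lt : ∀ F (a : ℝ), (g F : ℝ) < a → ∀ᶠ d : Capacity X in 𝒰, (d F : ℝ) < a := by
    intro F a h
    exact ((continuous_subtype_val.tendsto _).comp (hg F)).eventually (eventually_lt_nhds h)
  have ev_gt : ∀ F (a : ℝ), a < (g F : ℝ) → ∀ᶠ d : Capacity X in 𝒰, a < (d F : ℝ) := by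
    intro F a h
    exact ((continuous_subtype_val.tendsto _).comp (hg F)).eventually (eventually_gt_nhds h)
  refine ⟨c, Set.mem_univ _, ?_⟩
  change Filter.Tendsto id (𝒰 : Filter (Capacity X)) (𝓝 c)
  rw [tendsto_nhds_generateFrom_iff]
  rintro s (⟨F, a, rfl⟩ | ⟨U, a, rfl⟩) hs
  · obtain ⟨G, ⟨V, h1, h2⟩, h3⟩ := klt F a hs
    filter_upwards [ev_lt G a h3] with d hd
    exact lt_of_le_of_lt (show (d F : ℝ) ≤ d G from d.mono (h1.trans h2)) hd
  · obtain ⟨F, hFU, hF⟩ := hs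
    obtain ⟨V, G, hFV, hVG, hGU⟩ := Capacity.exists_between hFU
    have : a < (g G : ℝ) := lt_of_lt_of_le hF (kle F G ⟨V, hFV, hVG⟩)
    filter_upwards [ev_gt G a this] with d hd
    exact ⟨G, hGU, hd⟩

/-- `Mf(c)(F) = c(f⁻¹(F))`. -/
def map [CompactSpace X] [T2Space Y] (f : C(X, Y)) (c : Capacity X) : Capacity Y where
  toFun F := c (F.preimage f.continuous)
  map_bot' := by
    rw [show (⊥ : Closeds Y).preimage f.continuous = ⊥ from Closeds.ext (by rfl)]
    exact c.map_bot
  map_top' := by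
    rw [show (⊤ : Closeds Y).preimage f.continuous = ⊤ from Closeds.ext (by rfl)]
    exact c.map_top
  mono' F G h := c.mono fun _ hx => h hx
  usc' F a h := by
    obtain ⟨U, hFU, hU⟩ := c.usc _ a h
    refine ⟨⟨(f '' (U : Set X)ᶜ)ᶜ,
      ((U.isOpen.isClosed_compl.isCompact.image f.continuous).isClosed).isOpen_compl⟩, ?_, ?_⟩
    · rintro y hy ⟨x, hx, rfl⟩
      exact hx (hFU hy)
    · intro G hG
      refine hU _ fun x hx => ?_
      by_contra hxU
      exact hG hx ⟨x, hxU, rfl⟩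

theorem continuous_map [CompactSpace X] [T2Space Y] (f : C(X, Y)) :
    Continuous (map f) := by
  refine continuous_generateFrom_iff.mpr ?_
  rintro s (⟨F, a, rfl⟩ | ⟨U, a, rfl⟩)
  · exact isOpen_lt (F.preimage f.continuous) a
  · convert isOpen_gt (U.comap f) a using 1
    ext c
    constructor
    · rintro ⟨F, hF, ha⟩
      exact ⟨F.preimage f.continuous, fun _ hx => hF hx, ha⟩
    · rintro ⟨K, hK, ha⟩
      refine ⟨⟨f '' K, (K.isClosed.isCompact.image f.continuous).isClosed⟩,
        Set.image_subset_iff.mpr hK, lt_of_lt_of_le ha ?_⟩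
      exact c.mono (Set.subset_preimage_image f (K : Set X))

end Capacity

/-- The capacity functor `M` in the category of compacta. -/
def capacityFunctor : CompHaus.{u} ⥤ CompHaus.{u} where
  obj X := CompHaus.of (Capacity X)
  map f := CompHausLike.ofHom _ ⟨Capacity.map f.hom.hom, Capacity.continuous_map _⟩
  map_id _ := rfl
  map_comp _ _ := rfl

/-! ### `τ`-smooth capacities on Tychonoff spaces -/

/-- A `τ`-smooth capacity on a Tychonoff space `X`: a normalized monotone function on the closed
subsets of `X` (the empty one included) with values in the unit segment such that
`inf c(Fᵢ) ≤ c(G)` for each monotonically decreasing net `(Fᵢ)` of closed sets with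
`⋂ Fᵢ ⊆ G`, `G` closed. -/
structure TauCapacity (X : Type u) [TopologicalSpace X] where
  toFun : Closeds X → I
  map_bot' : toFun ⊥ = 0
  map_top' : toFun ⊤ = 1
  mono' : Monotone toFun
  smooth' : ∀ (ι : Type u) [Preorder ι] [IsDirectedOrder ι] [Nonempty ι]
    (F : ι → Closeds X), Antitone F → ∀ G : Closeds X, (⋂ i, (F i : Set X)) ⊆ G →
      ⨅ i, toFun (F i) ≤ toFun G

namespace TauCapacity

variable {X Y Z : Type u} [TopologicalSpace X] [TopologicalSpace Y] [TopologicalSpace Z]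

instance : FunLike (TauCapacity X) (Closeds X) I where
  coe := toFun
  coe_injective c c' h := by cases c; cases c'; congr

@[ext] theorem ext {c c' : TauCapacity X} (h : ∀ F, c F = c' F) : c = c' := DFunLike.ext _ _ h

theorem mono (c : TauCapacity X) {F G : Closeds X} (h : F ≤ G) : c F ≤ c G := c.mono' h

theorem map_bot (c : TauCapacity X) : c ⊥ = 0 := c.map_bot'

theorem map_top (c : TauCapacity X) : c ⊤ = 1 := c.map_top'

theorem smooth (c : TauCapacity X) {ι : Type u} [Preorder ι] [IsDirectedOrder ι] [Nonempty ι]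
    (F : ι → Closeds X) (hF : Antitone F) (G : Closeds X) (h : (⋂ i, (F i : Set X)) ⊆ G) :
    ⨅ i, c (F i) ≤ c G := c.smooth' ι F hF G h

/-- `M̌f(c)(F) = c(f⁻¹(F))`. -/
def map (f : C(X, Y)) (c : TauCapacity X) : TauCapacity Y where
  toFun F := c (F.preimage f.continuous)
  map_bot' := by
    rw [show (⊥ : Closeds Y).preimage f.continuous = ⊥ from Closeds.ext (by rfl)]
    exact c.map_bot
  map_top' := by
    rw [show (⊤ : Closeds Y).preimage f.continuous = ⊤ from Closeds.ext (by rfl)]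
    exact c.map_top
  mono' F G h := c.mono fun _ hx => h hx
  smooth' ι _ _ _ F hF G h := by
    refine c.smooth (fun i => (F i).preimage f.continuous)
      (fun i j hij _ hx => hF hij hx) _ ?_
    have := Set.preimage_mono (f := f) h
    rwa [Set.preimage_iInter] at this

/-- A `τ`-smooth capacity on a compactum is a capacity. -/
def toCapacity [CompactSpace X] [T2Space X] (c : TauCapacity X) : Capacity X where
  toFun := c
  map_bot' := c.map_bot
  map_top' := c.map_top
  mono' _ _ h := c.mono h
  usc' F a h := by
    by_contra! hcon
    let N : Type u := {G : Closeds X // ∃ V : Opens X, (F : Set X) ⊆ V ∧ (V : Set X) ⊆ G}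
    have : Nonempty Nᵒᵈ := ⟨OrderDual.toDual ⟨⊤, ⊤, by simp, by simp⟩⟩
    have : IsDirectedOrder Nᵒᵈ := ⟨by
      rintro ⟨G, V, hV, hVG⟩ ⟨G', V', hV', hVG'⟩
      refine ⟨OrderDual.toDual ⟨G ⊓ G', V ⊓ V', ?_, ?_⟩, ?_, ?_⟩
      · exact Set.subset_inter hV hV'
      · exact Set.inter_subset_inter hVG hVG'
      · exact (inf_le_left : G ⊓ G' ≤ G)
      · exact (inf_le_right : G ⊓ G' ≤ G')⟩
    have hle := c.smooth (ι := Nᵒᵈ) (fun G => (OrderDual.ofDual G).1) (fun _ _ h => h) F (by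
      intro x hx
      by_contra hxF
      have : (F : Set X) ⊆ (⟨{x}ᶜ, isOpen_compl_singleton⟩ : Opens X) := by
        rintro y hy rfl
        exact hxF hy
      obtain ⟨V, G, h1, h2, h3⟩ := Capacity.exists_between this
      exact h3 (Set.mem_iInter.mp hx (OrderDual.toDual ⟨G, V, h1, h2⟩)) rfl)
    obtain ⟨i, hi⟩ : ∃ i : Nᵒᵈ, (c (OrderDual.ofDual i).1 : ℝ) < a := by
      by_contra! hc
      by_cases ha : a ≤ 1
      · have ha0 : 0 ≤ a := (c F).2.1.trans h.le
        have h2 : (⟨a, ha0, ha⟩ : I) ≤ ⨅ i : Nᵒᵈ, c (OrderDual.ofDual i).1 :=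
          le_iInf fun i => hc i
        exact absurd (show a ≤ (c F : ℝ) from h2.trans hle) (not_le.mpr h)
      · exact ha ((hc (Classical.arbitrary _)).trans (c _).2.2)
    obtain ⟨G, V, hFV, hVG⟩ := i
    obtain ⟨H, hH, hle'⟩ := hcon V hFV
    have h3 : (c H : ℝ) ≤ c G := c.mono (hH.trans hVG)
    exact absurd (hle'.trans h3) (not_le.mpr hi)

/-- The map `e : M̌X → MβX` which sends a capacity `c` on `X` to the capacity
`F ↦ c(F ∩ X)` on the Stone-Čech compactification of `X`. -/
def extend (c : TauCapacity X) : Capacity (StoneCech X) :=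
  (c.map ⟨stoneCechUnit, continuous_stoneCechUnit⟩).toCapacity

@[simp] theorem extend_apply (c : TauCapacity X) (F : Closeds (StoneCech X)) :
    c.extend F = c (F.preimage continuous_stoneCechUnit) := rfl

/-- The topology on `M̌X` is the one induced from `MβX`. -/
instance : TopologicalSpace (TauCapacity X) := .induced extend inferInstance

theorem continuous_extend : Continuous (extend : TauCapacity X → _) := continuous_induced_dom

theorem preimage_closure_stoneCechUnit [T35Space X] (F : Closeds X) :
    (Closeds.closure (stoneCechUnit '' (F : Set X))).preimage continuous_stoneCechUnit = F :=
  Closeds.ext (by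
    have := isInducing_stoneCechUnit.closure_eq_preimage_closure_image (F : Set X)
    rw [F.isClosed.closure_eq] at this
    exact this.symm)

theorem extend_injective [T35Space X] : Function.Injective (extend : TauCapacity X → _) := by
  intro c c' h
  ext1 F
  have := DFunLike.congr_fun h (Closeds.closure (stoneCechUnit '' (F : Set X)))
  simpa only [extend_apply, preimage_closure_stoneCechUnit] using this

instance [T35Space X] : T35Space (TauCapacity X) :=
  Topology.IsEmbedding.t35Space (f := (extend : TauCapacity X → _)) ⟨⟨rfl⟩, extend_injective⟩

/-- The set of all `τ`-smooth capacities `c` with `c(F) ≥ α`. It is closed. -/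
def superlevel [T35Space X] (F : Closeds X) (α : I) : Closeds (TauCapacity X) where
  carrier := {c | α ≤ c F}
  isClosed' := by
    have h := (Capacity.superlevel (Closeds.closure (stoneCechUnit '' (F : Set X))) α).isClosed.preimage
      (continuous_extend (X := X))
    convert h using 1
    ext c
    change α ≤ c F ↔ α ≤ c.extend _
    rw [extend_apply, preimage_closure_stoneCechUnit]

theorem continuous_map (f : C(X, Y)) : Continuous (map f) := by
  refine continuous_induced_rng.mpr ?_
  let i : C(Y, StoneCech Y) := ⟨stoneCechUnit, continuous_stoneCechUnit⟩
  let g : C(StoneCech X, StoneCech Y) :=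
    ⟨stoneCechExtend (i.comp f).continuous, continuous_stoneCechExtend _⟩
  have : extend ∘ map f = Capacity.map g ∘ extend := by
    funext c
    ext1 F
    change c _ = c _
    congr 1
    refine Closeds.ext ?_
    change f ⁻¹' (stoneCechUnit ⁻¹' (F : Set _)) = stoneCechUnit ⁻¹' (g ⁻¹' (F : Set _))
    rw [← Set.preimage_comp, ← Set.preimage_comp]
    exact congrArg (· ⁻¹' (F : Set _)) (stoneCechExtend_extends (i.comp f).continuous).symm
  rw [this]
  exact (Capacity.continuous_map g).comp continuous_extend

end TauCapacity

/-- The category of Tychonoff spaces and continuous maps. -/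
abbrev Tych : Type (u + 1) :=
  ObjectProperty.FullSubcategory (fun X : TopCat.{u} => T35Space X)

instance (X : Tych.{u}) : T35Space X.obj := X.property

/-- The functor `M̌` of `τ`-smooth capacities in the category of Tychonoff spaces. -/
def tauCapacityFunctor : Tych.{u} ⥤ Tych.{u} where
  obj X := ⟨TopCat.of (TauCapacity X.obj), inferInstanceAs (T35Space (TauCapacity X.obj))⟩
  map f := ObjectProperty.homMk
    (TopCat.ofHom ⟨TauCapacity.map f.hom.hom, TauCapacity.continuous_map _⟩)
  map_id _ := rfl
  map_comp _ _ := rfl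

theorem t35Space_of_compact (X : Type u) [TopologicalSpace X] [CompactSpace X] [T2Space X] :
    T35Space X := inferInstance

/-- The inclusion `U` of the category of compacta into the category of Tychonoff spaces. -/
def compactaInclusion : CompHaus.{u} ⥤ Tych.{u} where
  obj X := ⟨X.toTop, t35Space_of_compact X.toTop⟩
  map f := ObjectProperty.homMk f.hom
  map_id _ := rfl
  map_comp _ _ := rfl

/-- `(F, η, μ)` is a monad (triple). -/
structure IsMonad {𝒞 : Type*} [Category 𝒞] (F : 𝒞 ⥤ 𝒞) (η : 𝟭 𝒞 ⟶ F) (μ : F ⋙ F ⟶ F) :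
    Prop where
  left_unit : ∀ X : 𝒞, η.app (F.obj X) ≫ μ.app X = 𝟙 (F.obj X)
  right_unit : ∀ X : 𝒞, F.map (η.app X) ≫ μ.app X = 𝟙 (F.obj X)
  assoc : ∀ X : 𝒞, F.map (μ.app X) ≫ μ.app X = μ.app (F.obj X) ≫ μ.app X

end CapacityMonad

open CapacityMonad

/-! Everything rests on one equivalence: the Sugeno supremum in the multiplication is attained, so
`α ≤ C.bind F ↔ α ≤ C (superlevel F α)` (`le_bind_apply`). The sets `superlevel F β`, `β < α`,
decrease to `superlevel F α`, and smoothness of `C` passes to the limit. The monad laws then reduce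
to computing preimages of superlevel sets under the unit and the multiplication.

The image of `extend` is found by restricting a capacity on `βX` along closures: compactness gives
continuity along decreasing nets, and the condition on traces brings the limit back to `X`.

Continuity of the multiplication is proved on compacta, where subbasic sets pull back to subbasic
sets (`exists_uniform_lt` handles the lower ones), and is transferred to Tychonoff spaces along
`extend`. -/

namespace CapacityMonad

/-- The Sugeno-type supremum of an antitone function, written in two ways. -/
theorem sSup_le_eq_iSup_inf {g : I → I} (hg : Antitone g) :
    sSup {α : I | α ≤ g α} = ⨆ α : I, α ⊓ g α := by
  apply le_antisymm
  · refine sSup_le fun α hα => ?_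
    exact (le_inf le_rfl hα).trans (le_iSup (fun α : I => α ⊓ g α) α)
  · refine iSup_le fun α => le_sSup ?_
    exact inf_le_right.trans (hg inf_le_left)

/-- Strictness is essential: for a general antitone `g` the supremum need not be attained. -/
theorem le_of_lt_iSup_inf {g : I → I} (hg : Antitone g) {α : I}
    (h : α < ⨆ β : I, β ⊓ g β) : α ≤ g α := by
  obtain ⟨β, hβ⟩ := lt_iSup_iff.mp h
  exact (hβ.le.trans inf_le_right).trans (hg (hβ.le.trans inf_le_left))

theorem le_iSup_inf {g : I → I} {α : I} (h : α ≤ g α) : α ≤ ⨆ β : I, β ⊓ g β :=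
  (le_inf le_rfl h).trans (le_iSup (fun β : I => β ⊓ g β) α)

namespace Capacity

variable {X : Type u} [TopologicalSpace X]

@[simp] theorem mem_superlevel {F : Closeds X} {α : I} {c : Capacity X} :
    c ∈ superlevel F α ↔ α ≤ c F := Iff.rfl

theorem superlevel_antitone (F : Closeds X) : Antitone (superlevel F) :=
  fun _ _ h _ hc => h.trans hc

/-- On a compactum, a capacity is continuous along decreasing nets of closed sets. -/
theorem iInf_le_of_iInter_subset [CompactSpace X] (c : Capacity X) {ι : Type*} [Preorder ι]
    [IsDirectedOrder ι] [Nonempty ι] (F : ι → Closeds X) (hF : Antitone F) (G : Closeds X)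
    (h : (⋂ i, (F i : Set X)) ⊆ G) : ⨅ i, c (F i) ≤ c G := by
  refine le_of_forall_gt fun a ha => ?_
  obtain ⟨U, hGU, hU⟩ := c.usc G a ha
  have hdir : Directed (· ⊇ ·) fun i => (F i : Set X) :=
    directed_of_isDirected_le fun i j hij => hF hij
  -- By compactness, a decreasing net with intersection inside the open set `U` is eventually inside
  -- `U`.
  obtain ⟨i, hi⟩ := exists_subset_nhds_of_isCompact' hdir (fun i => (F i).isClosed.isCompact)
    (fun i => (F i).isClosed) (U := U) fun x hx => U.isOpen.mem_nhds (hGU (h hx))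
  exact (iInf_le _ i).trans_lt (hU (F i) hi)

end Capacity

namespace TauCapacity

variable {X Y : Type u} [TopologicalSpace X] [TopologicalSpace Y]

@[simp] theorem mem_superlevel [T35Space X] {F : Closeds X} {α : I} {c : TauCapacity X} :
    c ∈ superlevel F α ↔ α ≤ c F := Iff.rfl

theorem map_apply (f : C(X, Y)) (c : TauCapacity X) (F : Closeds Y) :
    c.map f F = c (F.preimage f.continuous) := rfl

theorem superlevel_antitone [T35Space X] (F : Closeds X) : Antitone (superlevel F) :=
  fun _ _ h _ hc => h.trans hc

/-! ### The embedding into capacities on `βX` and its image. -/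

theorem isEmbedding_extend [T35Space X] : IsEmbedding (extend : TauCapacity X → _) :=
  ⟨⟨rfl⟩, extend_injective⟩

/-- A capacity on `βX` that does not distinguish closed sets by their points outside `X`
restricts to a `τ`-smooth capacity on `X`. -/
def restrict [T35Space X] (c : Capacity (StoneCech X))
    (hc : ∀ F G : Closeds (StoneCech X), (stoneCechUnit : X → StoneCech X) ⁻¹' F ⊆
      (stoneCechUnit : X → StoneCech X) ⁻¹' G → c F ≤ c G) : TauCapacity X where
  toFun F := c (Closeds.closure (stoneCechUnit '' (F : Set X)))
  map_bot' := by
    rw [← c.map_bot]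
    congr 1
    exact Closeds.ext (by simp)
  map_top' := by
    rw [← c.map_top]
    congr 1
    exact Closeds.ext (by simpa using denseRange_stoneCechUnit.closure_eq)
  mono' _ _ h := c.mono (closure_mono (Set.image_mono h))
  smooth' ι _ _ _ F hF G h := by
    have hF' : Antitone fun i => Closeds.closure (stoneCechUnit '' (F i : Set X)) :=
      fun i j hij => closure_mono (Set.image_mono (hF hij))
    -- The intersection of the closures may leave the closure of `G`, but only outside `X`, and `hc`
    -- ignores such points.
    refine (c.iInf_le_of_iInter_subset _ hF'
      (⨅ i, Closeds.closure (stoneCechUnit '' (F i : Set X))) (by simp)).trans (hc _ _ ?_)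
    intro x hx
    have hG := congrArg (fun K : Closeds X => (K : Set X)) (preimage_closure_stoneCechUnit G)
    refine hG.ge (h (Set.mem_iInter.mpr fun i => ?_))
    have hi := congrArg (fun K : Closeds X => (K : Set X)) (preimage_closure_stoneCechUnit (F i))
    refine hi.le ?_
    exact (iInf_le (fun i => Closeds.closure (stoneCechUnit '' (F i : Set X))) i) hx

theorem range_extend [T35Space X] : Set.range (extend : TauCapacity X → _) =
    {c | ∀ F G : Closeds (StoneCech X), (stoneCechUnit : X → StoneCech X) ⁻¹' F ⊆
      (stoneCechUnit : X → StoneCech X) ⁻¹' G → c F ≤ c G} := by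
  apply Set.Subset.antisymm
  · rintro _ ⟨c, rfl⟩ F G h
    exact c.mono h
  · intro c hc
    refine ⟨restrict c hc, ?_⟩
    ext1 F
    -- `F` and the closure of `F ∩ X` have the same trace on `X`, so `c` takes equal values on them.
    have h := congrArg (fun K : Closeds X => (K : Set X))
      (preimage_closure_stoneCechUnit (F.preimage continuous_stoneCechUnit))
    exact le_antisymm (hc _ _ h.le) (hc _ _ h.ge)

/-! ### Comparison of the two notions on compacta. -/

/-- A capacity on a compactum is `τ`-smooth. -/
def ofCapacity [CompactSpace X] (c : Capacity X) : TauCapacity X where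
  toFun := c
  map_bot' := c.map_bot
  map_top' := c.map_top
  mono' _ _ h := c.mono h
  smooth' _ _ _ _ F hF G h := c.iInf_le_of_iInter_subset F hF G h

theorem continuous_toCapacity [CompactSpace X] [T2Space X] :
    Continuous (toCapacity : TauCapacity X → Capacity X) := by
  -- The retraction of `βX` onto the compactum `X` factors `toCapacity` through `extend`.
  let r : C(StoneCech X, X) := ⟨stoneCechExtend continuous_id, continuous_stoneCechExtend _⟩
  have : (toCapacity : TauCapacity X → Capacity X) = Capacity.map r ∘ extend := by
    funext c
    ext1 F
    change c _ = c _
    congr 1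
    refine Closeds.ext ?_
    change (F : Set X) = stoneCechUnit ⁻¹' (r ⁻¹' (F : Set X))
    rw [← Set.preimage_comp]
    exact congrArg (· ⁻¹' (F : Set X)) (stoneCechExtend_extends (continuous_id (X := X))).symm
  rw [this]
  exact (Capacity.continuous_map r).comp continuous_extend

theorem continuous_ofCapacity [CompactSpace X] [T2Space X] :
    Continuous (ofCapacity : Capacity X → TauCapacity X) :=
  continuous_induced_rng.mpr
    (Capacity.continuous_map ⟨(stoneCechUnit : X → StoneCech X), continuous_stoneCechUnit⟩)

/-! ### Unit, multiplication and monad laws for smooth capacities. -/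

/-- The Dirac capacity at a point. -/
noncomputable def dirac (x : X) : TauCapacity X where
  toFun F := Set.indicator (F : Set X) 1 x
  map_bot' := by simp
  map_top' := by simp
  mono' F G h := Set.indicator_le_indicator_of_subset h (fun _ => zero_le_one) x
  smooth' ι _ _ _ F _ G h := by
    by_cases hx : x ∈ (G : Set X)
    · rw [Set.indicator_of_mem hx]
      exact le_top
    · obtain ⟨i, hi⟩ : ∃ i, x ∉ (F i : Set X) := by
        by_contra! hcon
        exact hx (h (Set.mem_iInter.mpr hcon))
      refine (iInf_le _ i).trans ?_
      rw [Set.indicator_of_notMem hi]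
      exact bot_le

theorem dirac_apply (x : X) (F : Closeds X) : dirac x F = Set.indicator (F : Set X) 1 x := rfl

theorem le_dirac_apply {x : X} {F : Closeds X} {α : I} : α ≤ dirac x F ↔ α = 0 ∨ x ∈ F := by
  rw [dirac_apply]
  by_cases hx : x ∈ (F : Set X)
  · rw [Set.indicator_of_mem hx]
    exact iff_of_true le_top (Or.inr hx)
  · rw [Set.indicator_of_notMem hx]
    exact ⟨fun h => Or.inl (le_bot_iff.mp h), fun h => h.elim (fun h => h.le) fun h => absurd h hx⟩

/-- The multiplication: the Sugeno integral of the evaluation at `F`. -/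
noncomputable def bind [T35Space X] (C : TauCapacity (TauCapacity X)) : TauCapacity X where
  toFun F := ⨆ α : I, α ⊓ C (superlevel F α)
  map_bot' := by
    refine le_bot_iff.mp (iSup_le fun α => ?_)
    rcases eq_or_ne α 0 with rfl | hα
    · exact inf_le_left
    · refine inf_le_right.trans ((C.mono (G := ⊥) fun c hc => (hα ?_).elim).trans C.map_bot.le)
      exact le_bot_iff.mp ((show α ≤ c ⊥ from hc).trans c.map_bot.le)
  map_top' := by
    refine top_le_iff.mp (le_iSup_inf (g := fun α => C (superlevel ⊤ α)) ?_)
    exact C.map_top.ge.trans (C.mono fun c _ => c.map_top.ge)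
  mono' F G h := iSup_mono fun α => inf_le_inf_left α
    (C.mono fun c hc => le_trans (b := c F) hc (c.mono h))
  smooth' ι _ _ _ F hF G h := by
    refine le_of_forall_lt fun a ha => ?_
    -- A level strictly below every supremum satisfies `α ≤ C (superlevel (F i) α)` for all `i`.
    -- Smoothness of `C` is then applied to these superlevel sets, and smoothness of each `c` puts
    -- their intersection inside `superlevel G α`.
    obtain ⟨α, haα, hα⟩ := _root_.exists_between ha
    refine haα.trans_le (le_iSup_inf (g := fun α => C (superlevel G α)) ?_)
    have h1 : ∀ i, α ≤ C (superlevel (F i) α) := fun i =>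
      le_of_lt_iSup_inf (C.mono'.comp_antitone (superlevel_antitone (F i)))
        (hα.trans_le (iInf_le _ i))
    refine (le_iInf h1).trans (C.smooth (fun i => superlevel (F i) α)
      (fun i j hij c hc => le_trans (b := c (F j)) hc (c.mono (hF hij))) _ fun c hc => ?_)
    exact (le_iInf fun i => Set.mem_iInter.mp hc i).trans (c.smooth F hF G h)

/-- The supremum defining the multiplication is attained. -/
theorem le_bind_apply [T35Space X] {C : TauCapacity (TauCapacity X)} {F : Closeds X} {α : I} :
    α ≤ C.bind F ↔ α ≤ C (superlevel F α) := by
  have hanti : Antitone fun β => C (superlevel F β) :=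
    C.mono'.comp_antitone (superlevel_antitone F)
  refine ⟨fun h => ?_, fun h => le_iSup_inf (g := fun α => C (superlevel F α)) h⟩
  rcases eq_or_ne α 0 with rfl | hα
  · exact bot_le
  have hlt : ∀ β < α, β ≤ C (superlevel F β) := fun β hβ =>
    le_of_lt_iSup_inf hanti (hβ.trans_le h)
  -- The levels below `α` index the net, nonempty because `α ≠ 0`; `ULift` puts the index type in
  -- the required universe.
  have : Nonempty (ULift.{u} (Set.Iio α)) := ⟨⟨0, bot_lt_iff_ne_bot.mpr hα⟩⟩
  refine le_trans ?_ (C.smooth (ι := ULift.{u} (Set.Iio α)) (fun β => superlevel F β.down.1)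
    (fun β γ h => superlevel_antitone F h) (superlevel F α) fun c hc => ?_)
  · refine le_of_forall_lt_imp_le_of_dense fun β hβ => le_iInf fun ⟨⟨γ, hγ⟩⟩ => ?_
    rcases le_total β γ with h' | h'
    · exact h'.trans (hlt γ hγ)
    · exact (hlt β hβ).trans (hanti h')
  · exact le_of_forall_lt_imp_le_of_dense fun β hβ => Set.mem_iInter.mp hc ⟨⟨β, hβ⟩⟩

theorem bind_dirac [T35Space X] (c : TauCapacity X) : (dirac c).bind = c := by
  ext1 F
  refine eq_of_forall_le_iff fun α => ?_
  rw [le_bind_apply, le_dirac_apply, mem_superlevel]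
  exact ⟨fun h => h.elim (fun h => h ▸ bot_le) id, Or.inr⟩

theorem bind_map_dirac [T35Space X] (h : Continuous (dirac : X → _)) (c : TauCapacity X) :
    (c.map ⟨dirac, h⟩).bind = c := by
  ext1 F
  refine eq_of_forall_le_iff fun α => ?_
  rw [le_bind_apply, map_apply]
  -- Level `0` is separate because every point, not only those of `F`, satisfies `0 ≤ dirac x F`.
  rcases eq_or_ne α 0 with rfl | hα
  · exact iff_of_true bot_le bot_le
  · rw [show (superlevel F α).preimage (ContinuousMap.mk dirac h).continuous = F from
      Closeds.ext (Set.ext fun x => le_dirac_apply.trans (or_iff_right hα))]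

theorem bind_map_bind [T35Space X] (h : Continuous (bind : TauCapacity (TauCapacity X) → _))
    (C : TauCapacity (TauCapacity (TauCapacity X))) :
    (C.map ⟨bind, h⟩).bind = C.bind.bind := by
  ext1 F
  refine eq_of_forall_le_iff fun α => ?_
  rw [le_bind_apply, le_bind_apply, le_bind_apply, map_apply]
  rw [show (superlevel F α).preimage (ContinuousMap.mk bind h).continuous =
    superlevel (superlevel F α) α from Closeds.ext (Set.ext fun C => le_bind_apply)]

end TauCapacity

/-! ### The capacity monad on compacta. -/

namespace Capacity

variable {X : Type u} [TopologicalSpace X] [CompactSpace X] [T2Space X]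

/-- The Dirac capacity at a point of a compactum. -/
noncomputable def dirac (x : X) : Capacity X := (TauCapacity.dirac x).toCapacity

theorem dirac_apply (x : X) (F : Closeds X) : dirac x F = Set.indicator (F : Set X) 1 x := rfl

theorem le_dirac_apply {x : X} {F : Closeds X} {α : I} : α ≤ dirac x F ↔ α = 0 ∨ x ∈ F :=
  TauCapacity.le_dirac_apply

theorem continuous_dirac : Continuous (dirac : X → Capacity X) := by
  have hlt : ∀ (F : Closeds X) (x : X) (a : ℝ), a < (dirac x F : ℝ) ↔
      a < 0 ∨ a < 1 ∧ x ∈ F := by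
    intro F x a
    rw [dirac_apply]
    by_cases hx : x ∈ (F : Set X)
    · rw [Set.indicator_of_mem hx]
      have hx' : x ∈ F := hx
      simp only [Pi.one_apply, Set.Icc.coe_one, hx', and_true]
      exact ⟨Or.inr, fun h => h.elim (fun h => h.trans one_pos) id⟩
    · rw [Set.indicator_of_notMem hx]
      have hx' : x ∉ F := hx
      simp [hx']
  refine continuous_generateFrom_iff.mpr ?_
  rintro s (⟨F, a, rfl⟩ | ⟨U, a, rfl⟩)
  · have h : IsClosed {x : X | a ≤ (dirac x F : ℝ)} := by
      rcases le_or_gt a 0 with h0 | h0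
      · convert isClosed_univ
        exact Set.eq_univ_of_forall fun x => h0.trans (dirac x F).2.1
      · rcases le_or_gt a 1 with h1 | h1
        · convert F.isClosed
          ext x
          change (⟨a, h0.le, h1⟩ : I) ≤ dirac x F ↔ _
          rw [le_dirac_apply, or_iff_right fun h => h0.ne' (congrArg Subtype.val h)]
          rfl
        · convert isClosed_empty
          exact Set.eq_empty_of_forall_notMem fun x hx => absurd (dirac x F).2.2
            (not_le.mpr (h1.trans_le hx))
    convert h.isOpen_compl using 1
    ext x
    simp
  · have : dirac ⁻¹' {c : Capacity X | ∃ F : Closeds X, (F : Set X) ⊆ U ∧ a < (c F : ℝ)} =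
        {_x | a < 0} ∪ {_x | a < 1} ∩ U := by
      ext x
      constructor
      · rintro ⟨F, hF, h⟩
        exact ((hlt F x a).mp h).imp id (And.imp id fun h => hF h)
      · rintro (h | ⟨h, hx⟩)
        · exact ⟨⊥, by simp, (hlt _ _ _).mpr (Or.inl h)⟩
        · exact ⟨⟨{x}, isClosed_singleton⟩, Set.singleton_subset_iff.mpr hx, (hlt _ _ _).mpr (Or.inr ⟨h, rfl⟩)⟩
    rw [this]
    exact isOpen_const.union (isOpen_const.inter U.isOpen)

/-- The multiplication of the capacity monad. -/
noncomputable def bind (C : Capacity (Capacity X)) : Capacity X :=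
  -- Passing through smooth capacities makes the attained supremum and the comparison of
  -- multiplications available by definitional unfolding.
  ((TauCapacity.ofCapacity C).map
    ⟨TauCapacity.ofCapacity, TauCapacity.continuous_ofCapacity⟩).bind.toCapacity

theorem bind_apply (C : Capacity (Capacity X)) (F : Closeds X) :
    C.bind F = sSup {α : I | α ≤ C (superlevel F α)} :=
  (sSup_le_eq_iSup_inf (C.mono'.comp_antitone (superlevel_antitone F))).symm

theorem le_bind_apply {C : Capacity (Capacity X)} {F : Closeds X} {α : I} :
    α ≤ C.bind F ↔ α ≤ C (superlevel F α) :=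
  TauCapacity.le_bind_apply

theorem lt_bind_apply {C : Capacity (Capacity X)} {F : Closeds X} {b : ℝ} (hb : b < C.bind F) :
    b < C (superlevel F (C.bind F)) :=
  hb.trans_le (le_bind_apply.mp (le_refl (C.bind F)))

/-- A closed set of capacities that exceed `b` on some closed subset of `U` does so uniformly. -/
theorem exists_uniform_lt {K : Closeds (Capacity X)} {U : Opens X} {b : ℝ}
    (hK : (K : Set (Capacity X)) ⊆ {c | ∃ F : Closeds X, (F : Set X) ⊆ U ∧ b < (c F : ℝ)}) :
    ∃ G : Closeds X, (G : Set X) ⊆ U ∧ ∃ α : ℝ, b < α ∧ ∀ c ∈ K, α ≤ c G := by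
  refine K.isClosed.isCompact.induction_on (p := fun s => ∃ G : Closeds X, (G : Set X) ⊆ U ∧
    ∃ α : ℝ, b < α ∧ ∀ c ∈ s, α ≤ c G) ?_ ?_ ?_ ?_
  · exact ⟨⊥, by simp, b + 1, by simp, by simp⟩
  · rintro s t hst ⟨G, hG, α, hα, h⟩
    exact ⟨G, hG, α, hα, fun c hc => h c (hst hc)⟩
  · rintro s t ⟨G, hG, α, hα, h⟩ ⟨G', hG', α', hα', h'⟩
    refine ⟨G ⊔ G', Set.union_subset hG hG', min α α', lt_min hα hα', ?_⟩
    rintro c (hc | hc)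
    · exact (min_le_left _ _).trans ((h c hc).trans (c.mono le_sup_left))
    · exact (min_le_right _ _).trans ((h' c hc).trans (c.mono le_sup_right))
  · intro c hc
    obtain ⟨F, hFU, hF⟩ := hK hc
    -- Interposing `V ⊆ G` and `b < α` makes one pair `(G, α)` serve a whole neighbourhood of `c`;
    -- finitely many pairs are merged by union and minimum.
    obtain ⟨V, G, hFV, hVG, hGU⟩ := Capacity.exists_between hFU
    obtain ⟨α, hbα, hα⟩ := _root_.exists_between hF
    refine ⟨_, mem_nhdsWithin_of_mem_nhds ((isOpen_gt V α).mem_nhds ⟨F, hFV, hα⟩),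
      G, hGU, α, hbα, ?_⟩
    rintro d ⟨H, hHV, hH⟩
    exact hH.le.trans (d.mono (hHV.trans hVG))

/-- For `0 < a ≤ 1` the preimage of `O₋(F, a)` is `O₋(superlevel F a, a)`; for `b ≥ 0` the preimage
of `O₊(U, b)` is `O₊(O₊(U, b), b)`. Other thresholds give trivial sets. -/
theorem continuous_bind : Continuous (bind : Capacity (Capacity X) → Capacity X) := by
  refine continuous_generateFrom_iff.mpr ?_
  rintro s (⟨F, a, rfl⟩ | ⟨U, b, rfl⟩)
  · rcases le_or_gt a 0 with h0 | h0
    · convert isOpen_empty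
      exact Set.eq_empty_of_forall_notMem fun C hC =>
        absurd (C.bind F).2.1 (not_le.mpr (lt_of_lt_of_le hC h0))
    · rcases le_or_gt a 1 with h1 | h1
      · convert isOpen_lt (superlevel F ⟨a, h0.le, h1⟩) a using 1
        ext C
        exact lt_iff_lt_of_le_iff_le (le_bind_apply (α := ⟨a, h0.le, h1⟩))
      · convert isOpen_univ
        exact Set.eq_univ_of_forall fun C => lt_of_le_of_lt (C.bind F).2.2 h1
  · rcases lt_or_ge b 0 with h0 | h0
    · convert isOpen_univ
      exact Set.eq_univ_of_forall fun C => ⟨⊥, by simp, h0.trans_le (C.bind ⊥).2.1⟩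
    · convert isOpen_gt ⟨_, isOpen_gt U b⟩ b using 1
      ext C
      constructor
      · rintro ⟨F, hFU, hF⟩
        exact ⟨superlevel F (C.bind F), fun c hc => ⟨F, hFU, lt_of_lt_of_le hF hc⟩,
          lt_bind_apply hF⟩
      · rintro ⟨K, hK, hCK⟩
        obtain ⟨G, hGU, α, hbα, hα⟩ := exists_uniform_lt hK
        refine ⟨G, hGU, ?_⟩
        -- A member of `K` is needed to see `α ≤ 1`; `K` is nonempty since `C K > b ≥ 0`.
        obtain ⟨c, hc⟩ : (K : Set (Capacity X)).Nonempty := by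
          by_contra hne
          have : K = ⊥ := Closeds.ext (by simpa [Set.not_nonempty_iff_eq_empty] using hne)
          rw [this, C.map_bot] at hCK
          exact absurd hCK (not_lt.mpr h0)
        let α' : I := ⟨α, h0.trans hbα.le, (hα c hc).trans (c G).2.2⟩
        have hle : α' ⊓ C K ≤ C.bind G := by
          refine le_bind_apply.mpr (inf_le_right.trans (C.mono fun d hd => ?_))
          exact inf_le_left.trans (show α' ≤ d G from hα d hd)
        refine lt_of_lt_of_le ?_ (show ((α' ⊓ C K : I) : ℝ) ≤ C.bind G from hle)
        rcases min_choice α' (C K) with h | h <;> rw [h]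
        · exact hbα
        · exact hCK

theorem bind_dirac (c : Capacity X) : (dirac c).bind = c := by
  ext1 F
  refine eq_of_forall_le_iff fun α => ?_
  rw [le_bind_apply, le_dirac_apply, mem_superlevel]
  exact ⟨fun h => h.elim (fun h => h ▸ bot_le) id, Or.inr⟩

theorem bind_map_dirac (c : Capacity X) :
    (c.map ⟨dirac, continuous_dirac⟩).bind = c := by
  ext1 F
  refine eq_of_forall_le_iff fun α => le_bind_apply.trans ?_
  rcases eq_or_ne α 0 with rfl | hα
  · exact iff_of_true bot_le bot_le
  · change α ≤ c _ ↔ _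
    rw [show (superlevel F α).preimage (ContinuousMap.mk dirac continuous_dirac).continuous = F from
      Closeds.ext (Set.ext fun x => le_dirac_apply.trans (or_iff_right hα))]

theorem bind_map_bind (C : Capacity (Capacity (Capacity X))) :
    (C.map ⟨bind, continuous_bind⟩).bind = C.bind.bind := by
  ext1 F
  refine eq_of_forall_le_iff fun α => ?_
  rw [le_bind_apply, le_bind_apply, le_bind_apply]
  change α ≤ C _ ↔ _
  rw [show (superlevel F α).preimage (ContinuousMap.mk bind continuous_bind).continuous =
    superlevel (superlevel F α) α from Closeds.ext (Set.ext fun C => le_bind_apply)]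

end Capacity

/-! ### Continuity on Tychonoff spaces by transfer along `extend`. -/

namespace TauCapacity

variable {X : Type u} [TopologicalSpace X]

theorem continuous_dirac : Continuous (dirac : X → TauCapacity X) :=
  continuous_induced_rng.mpr
    (Capacity.continuous_dirac.comp (continuous_stoneCechUnit (α := X)))

theorem continuous_bind [T35Space X] :
    Continuous (bind : TauCapacity (TauCapacity X) → TauCapacity X) :=
  -- The superlevel sets on `βX` pull back under `extend` to those of the traces on `X`, so `extend
  -- ∘ bind` unfolds to this composite.
  continuous_induced_rng.mpr (Capacity.continuous_bind.comp
    (continuous_toCapacity.comp (continuous_map ⟨extend, continuous_extend⟩)))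

end TauCapacity

/-! ### Categorical packaging. -/

/-- The unit of the monad of `τ`-smooth capacities. -/
noncomputable def tauUnit : 𝟭 Tych.{u} ⟶ tauCapacityFunctor where
  app X := ObjectProperty.homMk
    (TopCat.ofHom ⟨TauCapacity.dirac (X := X.obj), TauCapacity.continuous_dirac⟩)
  naturality _ _ _ := rfl

/-- The multiplication of the monad of `τ`-smooth capacities. -/
noncomputable def tauMul : tauCapacityFunctor.{u} ⋙ tauCapacityFunctor ⟶ tauCapacityFunctor where
  app X := ObjectProperty.homMk
    (TopCat.ofHom ⟨TauCapacity.bind (X := X.obj), TauCapacity.continuous_bind⟩)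
  -- The preimage of `superlevel F α` under `map f` is, by definition, the superlevel set of the
  -- preimage of `F`.
  naturality _ _ _ := rfl

theorem isMonad_tau : IsMonad tauCapacityFunctor.{u} tauUnit tauMul where
  left_unit X := by
    ext c
    exact TauCapacity.bind_dirac (X := X.obj) c
  right_unit X := by
    ext c
    exact TauCapacity.bind_map_dirac (X := X.obj) TauCapacity.continuous_dirac c
  assoc X := by
    ext c
    exact TauCapacity.bind_map_bind (X := X.obj) TauCapacity.continuous_bind c

/-- The unit of the capacity monad. -/
noncomputable def capacityUnit : 𝟭 CompHaus.{u} ⟶ capacityFunctor where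
  app X := CompHausLike.ofHom _ ⟨Capacity.dirac (X := X), Capacity.continuous_dirac⟩
  naturality _ _ _ := rfl

/-- The multiplication of the capacity monad. -/
noncomputable def capacityMul : capacityFunctor.{u} ⋙ capacityFunctor ⟶ capacityFunctor where
  app X := CompHausLike.ofHom _ ⟨Capacity.bind (X := X), Capacity.continuous_bind⟩
  naturality _ _ _ := rfl

theorem isMonad_capacity : IsMonad capacityFunctor.{u} capacityUnit capacityMul where
  left_unit X := by
    ext c
    exact Capacity.bind_dirac (X := X) c
  right_unit X := by
    ext c
    exact Capacity.bind_map_dirac (X := X) c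
  assoc X := by
    ext c
    exact Capacity.bind_map_bind (X := X) c

/-- On compacta, `τ`-smooth capacities are the same as capacities. -/
def tauCapacityIso :
    compactaInclusion ⋙ tauCapacityFunctor ≅ capacityFunctor.{u} ⋙ compactaInclusion where
  hom :=
    { app X := ObjectProperty.homMk
        (TopCat.ofHom ⟨TauCapacity.toCapacity (X := X), TauCapacity.continuous_toCapacity⟩)
      naturality _ _ _ := rfl }
  inv :=
    { app X := ObjectProperty.homMk
        (TopCat.ofHom ⟨TauCapacity.ofCapacity (X := X), TauCapacity.continuous_ofCapacity⟩)
      naturality _ _ _ := rfl }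
  hom_inv_id := rfl
  inv_hom_id := rfl

end CapacityMonad

theorem mainTheorem2 :
    -- capacities on `X` are the capacities on `βX` with `c(F) ≤ c(G)` whenever `F ∩ X ⊆ G`
    (∀ X : Tych.{u},
      IsEmbedding (TauCapacity.extend : TauCapacity X.obj → Capacity (StoneCech X.obj)) ∧
      Set.range (TauCapacity.extend : TauCapacity X.obj → Capacity (StoneCech X.obj)) =
        {c | ∀ F G : Closeds (StoneCech X.obj),
          (stoneCechUnit : X.obj → StoneCech X.obj) ⁻¹' (F : Set (StoneCech X.obj)) ⊆
            (stoneCechUnit : X.obj → StoneCech X.obj) ⁻¹' (G : Set (StoneCech X.obj)) →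
          c F ≤ c G}) ∧
    -- the monad in the category of Tychonoff spaces
    ∃ (η : 𝟭 Tych.{u} ⟶ tauCapacityFunctor)
      (μ : tauCapacityFunctor ⋙ tauCapacityFunctor ⟶ tauCapacityFunctor),
      (∀ (X : Tych.{u}) (x : X.obj) (F : Closeds X.obj),
        TauCapacity.toFun ((η.app X).hom.hom x) F = Set.indicator (F : Set X.obj) 1 x) ∧
      (∀ (X : Tych.{u}) (C : TauCapacity (TauCapacity X.obj)) (F : Closeds X.obj),
        TauCapacity.toFun ((μ.app X).hom.hom C) F =
          ⨆ α : I, α ⊓ C (TauCapacity.superlevel F α)) ∧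
      IsMonad tauCapacityFunctor η μ ∧
    -- the capacity monad in the category of compacta
    ∃ (ηc : 𝟭 CompHaus.{u} ⟶ capacityFunctor)
      (μc : capacityFunctor ⋙ capacityFunctor ⟶ capacityFunctor),
      (∀ (X : CompHaus.{u}) (x : X) (F : Closeds X),
        Capacity.toFun ((ηc.app X).hom.hom x) F = Set.indicator (F : Set X) 1 x) ∧
      (∀ (X : CompHaus.{u}) (C : Capacity (Capacity X)) (F : Closeds X),
        Capacity.toFun ((μc.app X).hom.hom C) F =
          sSup {α : I | α ≤ C (Capacity.superlevel F α)}) ∧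
      IsMonad capacityFunctor ηc μc ∧
    -- on compacta the former monad coincides with the latter one
    ∃ j : compactaInclusion ⋙ tauCapacityFunctor ≅ capacityFunctor.{u} ⋙ compactaInclusion,
      (∀ (X : CompHaus.{u}) (c : TauCapacity X) (F : Closeds X),
        Capacity.toFun ((j.hom.app X).hom.hom c) F = c F) ∧
      (∀ X : CompHaus.{u},
        η.app (compactaInclusion.obj X) ≫ j.hom.app X = compactaInclusion.map (ηc.app X)) ∧
      (∀ X : CompHaus.{u},
        μ.app (compactaInclusion.obj X) ≫ j.hom.app X =
          tauCapacityFunctor.map (j.hom.app X) ≫ j.hom.app (capacityFunctor.obj X) ≫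
            compactaInclusion.map (μc.app X)) :=
  ⟨fun _ => ⟨TauCapacity.isEmbedding_extend, TauCapacity.range_extend⟩,
    tauUnit, tauMul, fun _ _ _ => rfl, fun _ _ _ => rfl, isMonad_tau,
    capacityUnit, capacityMul, fun _ _ _ => rfl, fun _ => Capacity.bind_apply, isMonad_capacity,
    tauCapacityIso, fun _ _ _ => rfl, fun _ => rfl, fun _ => rfl⟩
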